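/- Let $D$ be an infinite integral domain with quotient field $K$, and let $\operatorname{Int}(D)=\{f\in K[X]: f(D)\subseteq D\}$. For an extension $A\supseteq D$ of integral domains, where $A$ has quotient field $L$, let $\operatorname{Int}(D,A)=\{f\in L[X]: f(D)\subseteq A\}$; the extension is *polynomially regular* if $\operatorname{Int}(D,A)$ is generated by $\operatorname{Int}(D)$ as an $A$-module. The domain $D$ is *polynomially L-regular* if $\operatorname{Int}(S^{-1}D)=S^{-1}\operatorname{Int}(D)$ for every multiplicative subset $S$ of $D$ with $0\notin S$. For a nonzero fractional ideal $I$ of $D$ put $I^{-1}=\{x\in K: xI\subseteq D\}$, $I_v=(I^{-1})^{-1}$, and $I_t=\bigcup_J J_v$, where $J$ ranges over the nonzero finitely generated fractional ideals contained in $I$. A *$t$-ideal* is a nonzero fractional ideal $I$ with $I_t=I$, and a *$t$-maximal ideal* is an ideal that is maximal among the $t$-ideals properly contained in $D$ (it is then prime). A prime ideal $\mathfrak p$ of $D$ is *$t$-localizing* if $\mathfrak pD_{\mathfrak p}$ is a $t$-ideal of $D_{\mathfrak p}$. An extension $A\supseteq D$ of domains is *$t$-linked* if $I_t=D$ implies $(IA)_t=A$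 for every nonzero ideal $I$ of $D$, and *locally $t$-linked* if $A_{\mathfrak p}=(D\setminus\mathfrak p)^{-1}A$ is a $t$-linked extension of $D_{\mathfrak p}$ for every prime ideal $\mathfrak p$ of $D$. A domain is *polynomially L-$t$-regular* if every locally $t$-linked extension of it is polynomially regular. These notions are applied in the same way to any domain in place of $D$. **Theorem.** Assume that $\operatorname{Int}(D)$ is flat as a $D$-module. Then $D$ is polynomially L-$t$-regular if and only if $D$ is polynomially L-regular and $D_{\mathfrak p}$ is polynomially L-$t$-regular for every $t$-localizing $t$-maximal ideal $\mathfrak p$ of $D$ with finite residue field $D_{\mathfrak p}/\mathfrak pD_{\mathfrak p}$. -/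

import Mathlib

open Polynomial

noncomputable section

universe u v w

/-! ### Integer-valued polynomials and polynomial regularity -/

/-- `IntOn B L E` is the ring `{f ∈ L[X] : f(E) ⊆ B}` of polynomials over `L` that take values
in (the image of) `B` on the subset `E` of `L`. It is used for `B` a domain, `L` its fraction
field. -/
def IntOn (B : Type v) (L : Type w) [CommRing B] [CommRing L] [Algebra B L] (E : Set L) :
    Subalgebra B L[X] where
  carrier := {f | ∀ x ∈ E, f.eval x ∈ (algebraMap B L).range}
  mul_mem' hf hg x hx := by
    rw [eval_mul]; exact mul_mem (hf x hx) (hg x hx)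
  add_mem' hf hg x hx := by
    rw [eval_add]; exact add_mem (hf x hx) (hg x hx)
  algebraMap_mem' r x _ := by
    rw [Polynomial.algebraMap_apply, eval_C]; exact ⟨r, rfl⟩

/-- `Int(D, A) = {f ∈ L[X] : f(D) ⊆ A}`, where `L` is the fraction field of `A`. -/
def IntExt (D : Type u) (A : Type v) [CommRing D] [CommRing A] [Algebra D A] :
    Subalgebra A (FractionRing A)[X] :=
  IntOn A (FractionRing A)
    (Set.range fun d : D => algebraMap A (FractionRing A) (algebraMap D A d))

/-- `Int(D) = {f ∈ K[X] : f(D) ⊆ D}`, where `K` is the fraction field of `D`. -/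
def IntRing (D : Type u) [CommRing D] : Subalgebra D (FractionRing D)[X] :=
  IntOn D (FractionRing D) (Set.range (algebraMap D (FractionRing D)))

/-- An extension `A ⊇ D` of domains (with inclusion `h`) is polynomially regular if `Int(D, A)` is
generated by `Int(D)` as an `A`-module; here `K[X]` is mapped into `L[X]` through the inclusion
`K → L` of the fraction fields of `D` and `A`. -/
def IsPolynomiallyRegular (D : Type u) (A : Type v) [CommRing D] [CommRing A] [IsDomain A]
    [Algebra D A] (h : Function.Injective (algebraMap D A)) : Prop :=
  Subalgebra.toSubmodule (IntExt D A) =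
    Submodule.span A
      (Polynomial.map (IsFractionRing.map h : FractionRing D →+* FractionRing A) ''
        (IntRing D : Set (FractionRing D)[X]))

/-- A domain `D` is polynomially L-regular if `Int(S⁻¹D) = S⁻¹ Int(D)` inside `K[X]` for every
multiplicative subset `S` of `D` not containing zero; here `S⁻¹D` is realized inside the fraction
field `K`. -/
def IsPolynomiallyLRegular (D : Type u) [CommRing D] : Prop :=
  ∀ (S : Submonoid D) (hS : S ≤ nonZeroDivisors D),
    (IntOn (Localization.subalgebra (FractionRing D) S hS) (FractionRing D)
        (Localization.subalgebra (FractionRing D) S hS : Set (FractionRing D)) :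
      Set (FractionRing D)[X]) =
    {f | ∃ s ∈ S, s • f ∈ IntRing D}

/-! ### The `t`-closure -/

section Closure

variable {D : Type u} {K : Type v} [CommRing D] [CommRing K] [Algebra D K]

/-- `I⁻¹ = (D :_K I) = {x ∈ K : x I ⊆ D}` for a `D`-submodule `I` of the fraction field `K`. -/
def fracInv (I : Submodule D K) : Submodule D K := 1 / I

/-- `I_v = (I⁻¹)⁻¹`. -/
def vClosure (I : Submodule D K) : Submodule D K := fracInv (fracInv I)

/-- `I_t = ⋃ J_v`, with `J` ranging over the nonzero finitely generated fractional ideals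
contained in `I` (a finitely generated `D`-submodule of `K` is a fractional ideal). -/
def tClosure (I : Submodule D K) : Set K :=
  {x | ∃ J : Submodule D K, J.FG ∧ J ≠ ⊥ ∧ J ≤ I ∧ x ∈ vClosure J}

end Closure

/-- The `t`-closure `I_t ⊆ K` of an ideal `I` of a domain `D` with fraction field `K`. -/
def Ideal.tClosure {D : Type u} [CommRing D] (I : Ideal D) : Set (FractionRing D) :=
  _root_.tClosure (IsLocalization.coeSubmodule (FractionRing D) I)

/-- A `t`-ideal contained in `D`: a nonzero ideal `I` of `D` with `I_t = I`. -/
def IsTIdeal {D : Type u} [CommRing D] (I : Ideal D) : Prop :=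
  I ≠ ⊥ ∧ I.tClosure = algebraMap D (FractionRing D) '' (I : Set D)

/-- A `t`-maximal ideal: maximal among the `t`-ideals properly contained in `D`. -/
def IsTMaximal {D : Type u} [CommRing D] (p : Ideal D) : Prop :=
  Maximal (fun I : Ideal D => IsTIdeal I ∧ I ≠ ⊤) p

/-- A prime ideal `p` of `D` is `t`-localizing if `p D_p` is a `t`-ideal of `D_p`. -/
def IsTLocalizing {D : Type u} [CommRing D] (p : Ideal D) [p.IsPrime] : Prop :=
  IsTIdeal (p.map (algebraMap D (Localization.AtPrime p)))

/-! ### `t`-linked extensions -/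

/-- An extension `A` of a domain `D` is `t`-linked if `I_t = D` implies `(I A)_t = A` for every
nonzero ideal `I` of `D`. -/
def IsTLinked (D : Type u) (A : Type v) [CommRing D] [CommRing A] [Algebra D A] : Prop :=
  ∀ I : Ideal D, I ≠ ⊥ →
    I.tClosure = Set.range (algebraMap D (FractionRing D)) →
    (I.map (algebraMap D A)).tClosure = Set.range (algebraMap A (FractionRing A))

/-- An extension `A` of a domain `D` is locally `t`-linked if `A_p = (D ∖ p)⁻¹ A` is a `t`-linked
extension of `D_p` for every prime ideal `p` of `D`. -/
def IsLocallyTLinked (D : Type u) (A : Type v) [CommRing D] [CommRing A] [Algebra D A] : Prop :=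
  ∀ (p : Ideal D) [p.IsPrime],
    IsTLinked (Localization.AtPrime p)
      (Localization (Algebra.algebraMapSubmonoid A p.primeCompl))

/-- A domain `D` is polynomially L-`t`-regular if every locally `t`-linked extension of `D` is
polynomially regular. -/
def IsPolynomiallyLTRegular (D : Type u) [CommRing D] : Prop :=
  ∀ (A : Type u) [CommRing A] [IsDomain A] [Algebra D A]
    (h : Function.Injective (algebraMap D A)),
    IsLocallyTLinked D A → IsPolynomiallyRegular D A h

end

-- For the direct implication, localizations of D are locally t-linked over D, and an extension that
-- is locally t-linked over a localization of D is so over D (`IsLocallyTLinked.restrictScalars`).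
-- Regularity over D then carries over, because a polynomial mapping D into an algebra over S⁻¹D
-- also maps S⁻¹D into it (`mem_intOn_localization`).
--
-- For the converse, let A be locally t-linked and f in Int(D, A). The d in D with d f in A·Int(D)
-- form an ideal, and it suffices that no maximal ideal p contains it. If D/p is infinite, Lagrange
-- interpolation gives s outside p with s f in A[X] (`exists_C_mul_eq_map`). If D/p is finite and p
-- is not t-localizing, some finitely generated J inside p has trivial v-closure over D_p, hence
-- over A_p by t-linkedness. Each prime strictly below p has an infinite quotient, so it does not
-- contain the denominator ideal of any coefficient of f. Locally at p this ideal therefore contains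
-- a power of J, whose factors cancel one by one (`not_dvdIdeal_le_of_divClosureAt`). In the
-- remaining case p is t-localizing and t-maximal: regularity over D_p writes f through Int(D_p),
-- and L-regularity replaces Int(D_p) by Int(D) up to a denominator outside p.
--
-- The t-conditions are all handled as divisibilities: e/f lies in I⁻¹ exactly when f divides a e
-- for every generator a of I, and localizing at T allows an extra factor from T.

universe u

/-! ### Divisorial closure without fractions -/

/-- The element `c` lies in the divisorial closure of the extension to `T⁻¹B` of the ideal of `D`
generated by `s`, expressed through divisibility in `B`. -/
def DivClosureAt {D : Type*} [CommRing D] (T : Submonoid D) (B : Type*) [CommRing B] [Algebra D B]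
    (s : Set D) (c : D) : Prop :=
  ∀ e f : B, f ≠ 0 → (∀ a ∈ s, f ∣ algebraMap D B a * e) →
    ∃ t ∈ T, f ∣ algebraMap D B (t * c) * e

/-- The extension `T⁻¹D → T⁻¹A` is `t`-linked, expressed through divisibility. -/
def TLinkedAt {D : Type*} [CommRing D] (T : Submonoid D) (A : Type*) [CommRing A]
    [Algebra D A] : Prop :=
  ∀ s : Set D, s.Finite → (∃ a ∈ s, a ≠ 0) → DivClosureAt T D s 1 → DivClosureAt T A s 1

section Basic

variable {D : Type*} [CommRing D]

theorem DivClosureAt.mono_submonoid {T T' : Submonoid D} (hT : T ≤ T') {B : Type*} [CommRing B]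
    [Algebra D B] {s : Set D} {c : D} (h : DivClosureAt T B s c) : DivClosureAt T' B s c :=
  fun e f hf hs => by
    obtain ⟨t, ht, h'⟩ := h e f hf hs
    exact ⟨t, hT ht, h'⟩

theorem DivClosureAt.mono_of_subset_span {T : Submonoid D} {B : Type*} [CommRing B]
    [Algebra D B] {s s' : Set D} (hs : s ⊆ Ideal.span s') {c : D} (h : DivClosureAt T B s c) :
    DivClosureAt T B s' c := by
  intro e f hf hs'
  refine h e f hf fun a ha => ?_
  replace ha := hs ha
  induction ha using Submodule.span_induction with
  | mem x hx => exact hs' x hx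
  | zero => simp
  | add x y _ _ hx hy => rw [map_add, add_mul]; exact dvd_add hx hy
  | smul r x _ hx => rw [smul_eq_mul, map_mul, mul_assoc]; exact hx.mul_left _

theorem DivClosureAt.of_one {B : Type*} [CommRing B] [Algebra D B] {T : Submonoid D} {s : Set D}
    (h : DivClosureAt T B s 1) (c : D) : DivClosureAt T B s c := by
  intro e f hf hs
  obtain ⟨t, ht, h'⟩ := h e f hf hs
  refine ⟨t, ht, ?_⟩
  rw [mul_one] at h'
  rw [map_mul, mul_right_comm]
  exact h'.mul_right _

theorem divClosureAt_bot_image {A : Type*} [CommRing A] [Algebra D A] {s : Set D} :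
    DivClosureAt (⊥ : Submonoid A) A (algebraMap D A '' s) 1 ↔
      DivClosureAt (⊥ : Submonoid D) A s 1 := by
  simp [DivClosureAt]

end Basic

/-! ### The `t`-closure and `t`-linkedness as divisibility conditions -/

section FractionField

variable {D : Type*} [CommRing D] [IsDomain D]

/-- A fraction e/f lies in the inverse of the span exactly when f divides a e for each generator a,
so testing c against the inverse is the divisibility condition. -/
theorem mem_vClosure_span_iff {K : Type*} [Field K] [Algebra D K] [IsFractionRing D K]
    {s : Set D} {c : D} :
    algebraMap D K c ∈ vClosure (Submodule.span D (algebraMap D K '' s)) ↔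
      DivClosureAt ⊥ D s c := by
  have key : ∀ y : K, y ∈ fracInv (Submodule.span D (algebraMap D K '' s)) ↔
      ∀ a ∈ s, y * algebraMap D K a ∈ (1 : Submodule D K) := by
    intro y
    rw [fracInv, Submodule.mem_div_iff_forall_mul_mem]
    refine ⟨fun h a ha => h _ (Submodule.subset_span ⟨a, ha, rfl⟩), fun h x hx => ?_⟩
    induction hx using Submodule.span_induction with
    | mem x hx => obtain ⟨a, ha, rfl⟩ := hx; exact h a ha
    | zero => simp
    | add x y _ _ hx hy => rw [mul_add]; exact add_mem hx hy
    | smul r x _ hx => rw [mul_smul_comm]; exact Submodule.smul_mem _ _ hx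
  have frac : ∀ a e f : D, f ≠ 0 →
      (algebraMap D K e / algebraMap D K f * algebraMap D K a ∈ (1 : Submodule D K) ↔
        f ∣ a * e) := by
    intro a e f hf
    have hf' : algebraMap D K f ≠ 0 := by simpa using hf
    rw [Submodule.mem_one]
    constructor
    · rintro ⟨x, hx⟩
      refine ⟨x, IsFractionRing.injective D K ?_⟩
      rw [map_mul, map_mul, hx]
      field_simp
    · rintro ⟨x, hx⟩
      refine ⟨x, ?_⟩
      rw [div_mul_eq_mul_div, eq_div_iff hf', ← map_mul, ← map_mul, mul_comm x, ← hx, mul_comm]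
  rw [vClosure, fracInv, Submodule.mem_div_iff_forall_mul_mem]
  constructor
  · intro h e f hf hs
    refine ⟨1, rfl, ?_⟩
    have := h (algebraMap D K e / algebraMap D K f)
      ((key _).2 fun a ha => (frac a e f hf).2 (hs a ha))
    rw [mul_comm, frac _ _ _ hf] at this
    simpa using this
  · intro h y hy
    obtain ⟨e, f, hf, rfl⟩ := IsFractionRing.div_surjective (A := D) y
    have hf := nonZeroDivisors.ne_zero hf
    rw [key] at hy
    obtain ⟨t, ht, h'⟩ := h e f hf fun a ha => (frac a e f hf).1 (hy a ha)
    obtain rfl : t = 1 := ht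
    rw [mul_comm, frac _ _ _ hf]
    simpa using h'

theorem Ideal.mem_tClosure_iff {I : Ideal D} {x : FractionRing D} :
    x ∈ I.tClosure ↔ ∃ c, algebraMap D (FractionRing D) c = x ∧
      ∃ s : Set D, s ⊆ I ∧ s.Finite ∧ (∃ a ∈ s, a ≠ 0) ∧ DivClosureAt ⊥ D s c := by
  have inj := IsFractionRing.injective D (FractionRing D)
  constructor
  · rintro ⟨J, ⟨t, rfl⟩, hJ, hI, hx⟩
    have ht : ((t : Set (FractionRing D)) : Set (FractionRing D)) =
        algebraMap D (FractionRing D) '' {a | a ∈ I ∧ algebraMap D (FractionRing D) a ∈ t} := by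
      ext y
      constructor
      · intro hy
        obtain ⟨a, ha, rfl⟩ := (IsLocalization.mem_coeSubmodule _ _).1
          (hI (Submodule.subset_span hy))
        exact ⟨a, ⟨ha, hy⟩, rfl⟩
      · rintro ⟨a, ⟨_, ha⟩, rfl⟩
        exact ha
    -- Since J lies in D, the element 1 belongs to J⁻¹, and so J_v lies in D.
    have hc : ∃ c, algebraMap D (FractionRing D) c = x := by
      have := (Submodule.mem_div_iff_forall_mul_mem).1 hx 1 (by
        rw [fracInv, Submodule.mem_div_iff_forall_mul_mem]
        intro y hy
        obtain ⟨a, ha, rfl⟩ := (IsLocalization.mem_coeSubmodule _ _).1 (hI hy)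
        rw [one_mul]
        exact Submodule.mem_one.2 ⟨a, rfl⟩)
      rw [mul_one] at this
      exact Submodule.mem_one.1 this
    obtain ⟨c, rfl⟩ := hc
    refine ⟨c, rfl, {a | a ∈ I ∧ algebraMap D (FractionRing D) a ∈ t}, fun a ha => ha.1,
      (t.finite_toSet.preimage inj.injOn).subset fun a ha => ha.2, ?_, ?_⟩
    · by_contra! h
      refine hJ (Submodule.span_eq_bot.2 fun y hy => ?_)
      rw [ht] at hy
      obtain ⟨a, ha, rfl⟩ := hy
      rw [h a ha, map_zero]
    · rw [ht] at hx
      exact mem_vClosure_span_iff.1 hx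
  · rintro ⟨c, rfl, s, hsI, hs, ⟨a, ha, ha0⟩, h⟩
    refine ⟨Submodule.span D (algebraMap D _ '' s), Submodule.fg_span (hs.image _), ?_, ?_,
      mem_vClosure_span_iff.2 h⟩
    · intro h0
      have := Submodule.span_eq_bot.1 h0 _ ⟨a, ha, rfl⟩
      exact ha0 (by simpa using this)
    · rw [Submodule.span_le]
      rintro _ ⟨b, hb, rfl⟩
      exact (IsLocalization.mem_coeSubmodule _ _).2 ⟨b, hsI hb, rfl⟩

theorem isTIdeal_iff {I : Ideal D} : IsTIdeal I ↔ I ≠ ⊥ ∧ ∀ s : Set D, s ⊆ I → s.Finite →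
    (∃ a ∈ s, a ≠ 0) → ∀ c, DivClosureAt ⊥ D s c → c ∈ I := by
  have inj := IsFractionRing.injective D (FractionRing D)
  refine and_congr_right fun hI => ⟨fun h s hs hf hn c hc => ?_, fun h => ?_⟩
  · have : algebraMap D (FractionRing D) c ∈ I.tClosure :=
      Ideal.mem_tClosure_iff.2 ⟨c, rfl, s, hs, hf, hn, hc⟩
    rw [h] at this
    obtain ⟨c', hc', e⟩ := this
    rwa [← inj e]
  · ext x
    rw [Ideal.mem_tClosure_iff]
    constructor
    · rintro ⟨c, rfl, s, hs, hf, hn, hc⟩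
      exact ⟨c, h s hs hf hn c hc, rfl⟩
    · rintro ⟨c, hc, rfl⟩
      obtain ⟨b, hb, hb0⟩ := Submodule.exists_mem_ne_zero_of_ne_bot hI
      -- The nonzero b is adjoined because c may be zero, while J must be nonzero.
      refine ⟨c, rfl, {b, c}, ?_, by simp, ⟨b, by simp, hb0⟩, fun e f _ hs => ⟨1, rfl, ?_⟩⟩
      · rintro x (rfl | rfl)
        exacts [hb, hc]
      · simpa using hs c (by simp)

theorem Ideal.tClosure_eq_range_iff {I : Ideal D} :
    I.tClosure = Set.range (algebraMap D (FractionRing D)) ↔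
      ∃ s : Set D, s ⊆ I ∧ s.Finite ∧ (∃ a ∈ s, a ≠ 0) ∧ DivClosureAt ⊥ D s 1 := by
  have inj := IsFractionRing.injective D (FractionRing D)
  constructor
  · intro h
    have : (1 : FractionRing D) ∈ I.tClosure := by rw [h]; exact ⟨1, map_one _⟩
    obtain ⟨c, hc, h'⟩ := Ideal.mem_tClosure_iff.1 this
    obtain rfl : c = 1 := inj (by rw [hc, map_one])
    exact h'
  · rintro ⟨s, hs, hf, hn, h⟩
    ext x
    rw [Ideal.mem_tClosure_iff]
    constructor
    · rintro ⟨c, rfl, -⟩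
      exact ⟨c, rfl⟩
    · rintro ⟨c, rfl⟩
      exact ⟨c, rfl, s, hs, hf, hn, h.of_one c⟩

theorem isTLinked_iff {A : Type*} [CommRing A] [IsDomain A] [Algebra D A]
    (hinj : Function.Injective (algebraMap D A)) : IsTLinked D A ↔ TLinkedAt (⊥ : Submonoid D) A := by
  simp only [IsTLinked, Ideal.tClosure_eq_range_iff]
  constructor
  · rintro h s hs ⟨a, ha, ha0⟩ hd
    obtain ⟨s', hs', -, -, h'⟩ := h (Ideal.span s)
      (fun h0 => ha0 (by simpa [h0] using Ideal.subset_span (α := D) ha))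
      ⟨s, Ideal.subset_span, hs, ⟨a, ha, ha0⟩, hd⟩
    rw [Ideal.map_span] at hs'
    exact divClosureAt_bot_image.1 (h'.mono_of_subset_span hs')
  · rintro h I - ⟨s, hs, hf, ⟨a, ha, ha0⟩, hd⟩
    refine ⟨algebraMap D A '' s, ?_, hf.image _, ⟨_, ⟨a, ha, rfl⟩, ?_⟩,
      divClosureAt_bot_image.2 (h s hf ⟨a, ha, ha0⟩ hd)⟩
    · rintro _ ⟨b, hb, rfl⟩
      exact Ideal.mem_map_of_mem _ (hs hb)
    · rwa [Ne, map_eq_zero_iff _ hinj]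

end FractionField

/-! ### Localization of `t`-linkedness -/

section Localization

theorem exists_common_mem_dvd {D : Type*} [CommRing D] {B : Type*} [CommRing B] [Algebra D B]
    {S : Submonoid D} {f : B} {s : Set D} (hs : s.Finite) {e : D → B}
    (h : ∀ a ∈ s, ∃ w ∈ S, f ∣ algebraMap D B w * e a) :
    ∃ w ∈ S, ∀ a ∈ s, f ∣ algebraMap D B w * e a := by
  induction s, hs using Set.Finite.induction_on with
  | empty => exact ⟨1, one_mem _, by simp⟩
  | @insert a s _ _ ih =>
    obtain ⟨w, hw, h1⟩ := ih fun a ha => h a (Set.mem_insert_of_mem _ ha)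
    obtain ⟨w', hw', h2⟩ := h a (Set.mem_insert _ _)
    refine ⟨w * w', mul_mem hw hw', ?_⟩
    rintro b (rfl | hb)
    · rw [map_mul, mul_assoc]; exact h2.mul_left _
    · rw [map_mul, mul_right_comm]; exact (h1 b hb).mul_right _

variable {D : Type*} [CommRing D] (S : Submonoid D) {D' : Type*} [CommRing D'] [Algebra D D']

theorem isUnit_algebraMap_of_mem (B : Type*) {B' : Type*} [CommRing B] [CommRing B'] [Algebra D B]
    [Algebra B B'] [Algebra D B'] [IsScalarTower D B B']
    [IsLocalization (Algebra.algebraMapSubmonoid B S) B'] {t : D} (ht : t ∈ S) :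
    IsUnit (algebraMap D B' t) := by
  rw [IsScalarTower.algebraMap_apply D B B']
  exact IsLocalization.map_units B'
    (⟨_, t, ht, rfl⟩ : Algebra.algebraMapSubmonoid B S)

section Module

variable {B B' : Type*} [CommRing B] [CommRing B'] [Algebra D B] [Algebra B B'] [Algebra D B']
  [IsScalarTower D B B'] [IsLocalization (Algebra.algebraMapSubmonoid B S) B']

theorem exists_mul_eq_algebraMap (x : B') :
    ∃ t ∈ S, ∃ b : B, algebraMap D B' t * x = algebraMap B B' b := by
  obtain ⟨⟨b, _, t, ht, rfl⟩, h⟩ := IsLocalization.surj (Algebra.algebraMapSubmonoid B S) x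
  refine ⟨t, ht, b, ?_⟩
  rw [mul_comm, IsScalarTower.algebraMap_apply D B B']
  exact h

theorem algebraMap_dvd_algebraMap_iff (hinj : Function.Injective (algebraMap B B')) {f e : B} :
    algebraMap B B' f ∣ algebraMap B B' e ↔ ∃ t ∈ S, f ∣ algebraMap D B t * e := by
  constructor
  · rintro ⟨x, hx⟩
    obtain ⟨t, ht, b, h⟩ := exists_mul_eq_algebraMap S (B := B) x
    refine ⟨t, ht, b, hinj ?_⟩
    rw [map_mul, map_mul, ← h, hx, ← IsScalarTower.algebraMap_apply]
    ring
  · rintro ⟨t, ht, h⟩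
    have := map_dvd (algebraMap B B') h
    rw [map_mul, ← IsScalarTower.algebraMap_apply] at this
    exact (isUnit_algebraMap_of_mem S B ht).dvd_mul_left.1 this

variable [Algebra D' B'] [IsScalarTower D D' B']

/-- Denominators from S are units in B', so they can be cleared; finiteness of s provides one
denominator for all the divisibilities at once. The conditions `h₁` and `h₂` say that T and T' agree
up to divisibility, which covers both T' trivial in D_p and complements of corresponding primes. -/
theorem divClosureAt_image_iff (hinj : Function.Injective (algebraMap B B'))
    {T : Submonoid D} {T' : Submonoid D'} (hST : S ≤ T)
    (h₁ : ∀ t ∈ T, ∃ t' ∈ T', algebraMap D D' t ∣ t')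
    (h₂ : ∀ t' ∈ T', ∃ t ∈ T, t' ∣ algebraMap D D' t) {s : Set D} (hs : s.Finite) {c : D} :
    DivClosureAt T' B' (algebraMap D D' '' s) (algebraMap D D' c) ↔ DivClosureAt T B s c := by
  have hD : ∀ x : D, algebraMap D' B' (algebraMap D D' x) = algebraMap B B' (algebraMap D B x) :=
    fun x => by rw [← IsScalarTower.algebraMap_apply, ← IsScalarTower.algebraMap_apply]
  constructor
  · intro h e f hf hdvd
    obtain ⟨t', ht', h'⟩ := h (algebraMap B B' e) (algebraMap B B' f)
      ((map_ne_zero_iff _ hinj).2 hf) (by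
        rintro _ ⟨a, ha, rfl⟩
        rw [hD, ← map_mul]
        exact map_dvd _ (hdvd a ha))
    obtain ⟨t, ht, htt⟩ := h₂ t' ht'
    have h3 : algebraMap B B' f ∣ algebraMap B B' (algebraMap D B (t * c) * e) := by
      refine h'.trans ?_
      simp only [map_mul]
      rw [hD, ← hD t]
      exact mul_dvd_mul_right (mul_dvd_mul_right (map_dvd _ htt) _) _
    obtain ⟨w, hw, h4⟩ := (algebraMap_dvd_algebraMap_iff S hinj).1 h3
    refine ⟨w * t, mul_mem (hST hw) ht, ?_⟩
    rwa [mul_assoc, map_mul, mul_assoc]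
  · intro h e' f' hf' hdvd
    obtain ⟨u, hu, e, he⟩ := exists_mul_eq_algebraMap S (B := B) e'
    obtain ⟨v, hv, f, hf⟩ := exists_mul_eq_algebraMap S (B := B) f'
    have uu : IsUnit (algebraMap D B' u) := isUnit_algebraMap_of_mem S B hu
    have uv : IsUnit (algebraMap D B' v) := isUnit_algebraMap_of_mem S B hv
    have hf0 : f ≠ 0 := by
      rintro rfl
      rw [map_zero, uv.mul_right_eq_zero] at hf
      exact hf' hf
    have key : ∀ a ∈ s, ∃ w ∈ S, f ∣ algebraMap D B w * (algebraMap D B a * e) := by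
      intro a ha
      rw [← algebraMap_dvd_algebraMap_iff S hinj, ← hf, uv.mul_left_dvd, map_mul, ← he, ← hD]
      rw [mul_left_comm]
      exact (hdvd _ ⟨a, ha, rfl⟩).mul_left _
    obtain ⟨w, hw, h1⟩ := exists_common_mem_dvd hs key
    obtain ⟨t, ht, h2⟩ := h (algebraMap D B w * e) f hf0 fun a ha => by
      rw [mul_left_comm]; exact h1 a ha
    obtain ⟨t', ht', htt⟩ := h₁ t ht
    have h3 := map_dvd (algebraMap B B') h2
    have uw : IsUnit (algebraMap D B' w) := isUnit_algebraMap_of_mem S B hw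
    simp only [map_mul] at h3
    rw [← hf, ← he, ← hD, ← hD, ← hD w, ← IsScalarTower.algebraMap_apply D D' B' w,
      uv.mul_left_dvd, mul_left_comm, uw.dvd_mul_left, mul_left_comm, uu.dvd_mul_left] at h3
    refine ⟨t', ht', h3.trans ?_⟩
    rw [map_mul]
    exact mul_dvd_mul_right (mul_dvd_mul_right (map_dvd _ htt) _) _

end Module

theorem exists_finite_image_span_eq [IsLocalization S D'] {s' : Set D'} (hs' : s'.Finite) :
    ∃ s : Set D, s.Finite ∧ (s' ⊆ Ideal.span (algebraMap D D' '' s)) ∧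
      algebraMap D D' '' s ⊆ Ideal.span s' := by
  obtain ⟨b, hb⟩ := IsLocalization.exist_integer_multiples_of_finset S hs'.toFinset
  have hb' : ∀ a ∈ s', ∃ d : D, algebraMap D D' d = algebraMap D D' b * a := by
    intro a ha
    obtain ⟨d, hd⟩ := hb a (by simpa using ha)
    exact ⟨d, by rw [hd, Algebra.smul_def]⟩
  choose! g hg using hb'
  have ub : IsUnit (algebraMap D D' b) := IsLocalization.map_units D' b
  refine ⟨g '' s', hs'.image _, fun a ha => ?_, ?_⟩
  · have : algebraMap D D' (g a) ∈ Ideal.span (algebraMap D D' '' (g '' s')) :=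
      Ideal.subset_span ⟨_, ⟨a, ha, rfl⟩, rfl⟩
    rw [hg a ha] at this
    exact (Ideal.unit_mul_mem_iff_mem _ ub).1 this
  · rintro _ ⟨_, ⟨a, ha, rfl⟩, rfl⟩
    rw [hg a ha]
    exact Ideal.mul_mem_left _ _ (Ideal.subset_span ha)

variable [IsLocalization S D'] {A A' : Type*} [CommRing A] [CommRing A'] [Algebra D A] [Algebra A A']
  [Algebra D A'] [IsScalarTower D A A'] [IsLocalization (Algebra.algebraMapSubmonoid A S) A']
  [Algebra D' A'] [IsScalarTower D D' A']

theorem tLinkedAt_localization_iff (hS : S ≤ nonZeroDivisors D)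
    (hinj : Function.Injective (algebraMap A A'))
    {T : Submonoid D} {T' : Submonoid D'} (hST : S ≤ T)
    (h₁ : ∀ t ∈ T, ∃ t' ∈ T', algebraMap D D' t ∣ t')
    (h₂ : ∀ t' ∈ T', ∃ t ∈ T, t' ∣ algebraMap D D' t) :
    TLinkedAt T' A' ↔ TLinkedAt T A := by
  have injD : Function.Injective (algebraMap D D') := IsLocalization.injective D' hS
  have : IsLocalization (Algebra.algebraMapSubmonoid D S) D' := by
    rwa [Algebra.algebraMapSubmonoid_self]
  have eqD {s : Set D} (hs : s.Finite) :
      DivClosureAt T' D' (algebraMap D D' '' s) 1 ↔ DivClosureAt T D s 1 := by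
    have := divClosureAt_image_iff S (B := D) (B' := D') injD hST h₁ h₂ hs (c := 1)
    rwa [map_one] at this
  have eqA {s : Set D} (hs : s.Finite) :
      DivClosureAt T' A' (algebraMap D D' '' s) 1 ↔ DivClosureAt T A s 1 := by
    have := divClosureAt_image_iff S (B := A) (B' := A') hinj hST h₁ h₂ hs (c := 1)
    rwa [map_one] at this
  constructor
  · rintro h s hs ⟨a, ha, ha0⟩ hd
    rw [← eqA hs]
    exact h _ (hs.image _) ⟨_, ⟨a, ha, rfl⟩, (map_ne_zero_iff _ injD).2 ha0⟩ ((eqD hs).2 hd)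
  · rintro h s' hs' ⟨a, ha, ha0⟩ hd
    obtain ⟨s, hs, h3, h4⟩ := exists_finite_image_span_eq S hs'
    refine DivClosureAt.mono_of_subset_span h4 ((eqA hs).2 (h s hs ?_ ?_))
    · by_contra! h0
      refine ha0 ?_
      have : Ideal.span (algebraMap D D' '' s) = ⊥ := by
        rw [Ideal.span_eq_bot]
        rintro _ ⟨b, hb, rfl⟩
        rw [h0 b hb, map_zero]
      simpa [this] using h3 ha
    · exact (eqD hs).1 (DivClosureAt.mono_of_subset_span h3 hd)

end Localization

/-! ### Local `t`-linkedness under localization and restriction of scalars -/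

section LocallyTLinked

variable {D : Type*} [CommRing D] [IsDomain D] {A : Type*} [CommRing A] [IsDomain A] [Algebra D A]

theorem algebraMapSubmonoid_le_nonZeroDivisors (hinj : Function.Injective (algebraMap D A))
    {S : Submonoid D} (hS : S ≤ nonZeroDivisors D) :
    Algebra.algebraMapSubmonoid A S ≤ nonZeroDivisors A := by
  rintro _ ⟨t, ht, rfl⟩
  rw [mem_nonZeroDivisors_iff_ne_zero]
  exact (map_ne_zero_iff _ hinj).2 (nonZeroDivisors.ne_zero (hS ht))

theorem algebraMap_localization_injective {D' A' : Type*} [CommRing D'] [CommRing A']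
    [Algebra D D'] [Algebra A A'] [Algebra D A'] [Algebra D' A'] [IsScalarTower D A A']
    [IsScalarTower D D' A'] (S : Submonoid D) (hS : S ≤ nonZeroDivisors D) [IsLocalization S D']
    [IsLocalization (Algebra.algebraMapSubmonoid A S) A']
    (hinj : Function.Injective (algebraMap D A)) : Function.Injective (algebraMap D' A') := by
  rw [injective_iff_map_eq_zero]
  intro x hx
  obtain ⟨⟨d, t⟩, h⟩ := IsLocalization.surj S x
  have h' := congrArg (algebraMap D' A') h
  rw [map_mul, hx, zero_mul, ← IsScalarTower.algebraMap_apply,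
    IsScalarTower.algebraMap_apply D A A', eq_comm,
    map_eq_zero_iff _ (IsLocalization.injective A' (algebraMapSubmonoid_le_nonZeroDivisors hinj hS)),
    map_eq_zero_iff _ hinj] at h'
  rw [h', map_zero] at h
  exact ((IsLocalization.map_units D' t).mul_left_eq_zero).1 h

theorem isLocallyTLinked_iff (hinj : Function.Injective (algebraMap D A)) :
    IsLocallyTLinked D A ↔ ∀ (p : Ideal D) [p.IsPrime], TLinkedAt p.primeCompl A := by
  refine forall_congr' fun p => forall_congr' fun hp => ?_
  have hp0 := p.primeCompl_le_nonZeroDivisors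
  have hA0 := algebraMapSubmonoid_le_nonZeroDivisors hinj hp0
  have : IsDomain (Localization (Algebra.algebraMapSubmonoid A p.primeCompl)) :=
    IsLocalization.isDomain_localization hA0
  rw [isTLinked_iff (algebraMap_localization_injective p.primeCompl hp0 hinj)]
  exact tLinkedAt_localization_iff p.primeCompl hp0 (IsLocalization.injective _ hA0) le_rfl
    (fun t ht => ⟨1, rfl, (IsLocalization.map_units _ (⟨t, ht⟩ : p.primeCompl)).dvd⟩)
    (fun t' ht' => ⟨1, one_mem _, by rw [Submonoid.mem_bot.1 ht']; exact one_dvd _⟩)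

/-- Localizations of a domain are locally `t`-linked. -/
theorem isLocallyTLinked_localization (S : Submonoid D) (hS : S ≤ nonZeroDivisors D)
    [IsLocalization S A] : IsLocallyTLinked D A := by
  have inj : Function.Injective (algebraMap D A) := IsLocalization.injective A hS
  have : IsLocalization (Algebra.algebraMapSubmonoid D S) A := by
    rwa [Algebra.algebraMapSubmonoid_self]
  rw [isLocallyTLinked_iff inj]
  intro p hp s hs _ hd e' f' hf' hdvd
  obtain ⟨u, hu, e, he⟩ := exists_mul_eq_algebraMap S (B := D) e'
  obtain ⟨v, hv, f, hf⟩ := exists_mul_eq_algebraMap S (B := D) f'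
  have uu : IsUnit (algebraMap D A u) := isUnit_algebraMap_of_mem S D hu
  have uv : IsUnit (algebraMap D A v) := isUnit_algebraMap_of_mem S D hv
  have hf0 : f ≠ 0 := by
    rintro rfl
    rw [map_zero, uv.mul_right_eq_zero] at hf
    exact hf' hf
  -- The divisibilities in S⁻¹D become divisibilities in D after multiplication by a common w in S,
  -- which is absorbed into the numerator.
  obtain ⟨w, hw, h1⟩ := exists_common_mem_dvd (B := D) (S := S) (f := f) (e := fun a => a * e) hs
    fun a ha => by
      rw [← algebraMap_dvd_algebraMap_iff (B := D) (B' := A) S inj, ← hf, uv.mul_left_dvd, map_mul,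
        ← he, mul_left_comm]
      exact (hdvd a ha).mul_left _
  obtain ⟨t, ht, h2⟩ := hd (w * e) f hf0 fun a ha => by
    have := h1 a ha
    simp only [Algebra.algebraMap_self, RingHom.id_apply] at this ⊢
    rwa [mul_left_comm]
  refine ⟨t, ht, ?_⟩
  have h3 := map_dvd (algebraMap D A) h2
  have uw : IsUnit (algebraMap D A w) := isUnit_algebraMap_of_mem S D hw
  simp only [Algebra.algebraMap_self, RingHom.id_apply] at h3
  simp only [map_mul] at h3 ⊢
  rwa [← hf, uv.mul_left_dvd, mul_left_comm, uw.dvd_mul_left, ← he,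
    mul_left_comm, uu.dvd_mul_left] at h3

variable {D' : Type*} [CommRing D'] [Algebra D D']

/-- The elements `d` of `D` such that `f` divides `d * e`. -/
def dvdIdeal (D : Type*) [CommRing D] {B : Type*} [CommRing B] [Algebra D B] (f e : B) :
    Ideal D where
  carrier := {d | f ∣ algebraMap D B d * e}
  add_mem' ha hb := by
    simp only [Set.mem_ofPred_eq, map_add, add_mul] at *
    exact dvd_add ha hb
  zero_mem' := by simp
  smul_mem' r a ha := by
    simp only [Set.mem_ofPred_eq, smul_eq_mul, map_mul, mul_assoc] at *
    exact ha.mul_left _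

theorem mem_dvdIdeal {D : Type*} [CommRing D] {B : Type*} [CommRing B] [Algebra D B] {f e : B}
    {d : D} : d ∈ dvdIdeal D f e ↔ f ∣ algebraMap D B d * e := Iff.rfl

/-- Supplies the compatibility conditions of `divClosureAt_image_iff` for a prime of D' and its
contraction. -/
theorem primeCompl_comap_compat {D : Type*} [CommRing D] (S : Submonoid D)
    {D' : Type*} [CommRing D'] [Algebra D D'] [IsLocalization S D'] (q : Ideal D') [hq : q.IsPrime] :
    S ≤ (q.comap (algebraMap D D')).primeCompl ∧
    (∀ t ∈ (q.comap (algebraMap D D')).primeCompl, ∃ t' ∈ q.primeCompl, algebraMap D D' t ∣ t') ∧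
    (∀ t' ∈ q.primeCompl, ∃ t ∈ (q.comap (algebraMap D D')).primeCompl,
      t' ∣ algebraMap D D' t) := by
  have hSq : S ≤ (q.comap (algebraMap D D')).primeCompl := fun t ht hq' =>
    hq.ne_top (Ideal.eq_top_of_isUnit_mem _ hq' (IsLocalization.map_units D' (⟨t, ht⟩ : S)))
  refine ⟨hSq, fun t ht => ⟨_, ht, dvd_rfl⟩, fun t' ht' => ?_⟩
  obtain ⟨⟨d, t⟩, hdt⟩ := IsLocalization.surj S t'
  refine ⟨d, fun hd => ?_, ⟨_, hdt.symm⟩⟩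
  have : t' * algebraMap D D' t ∈ q := by rw [hdt]; exact hd
  rcases hq.mem_or_mem this with h1 | h1
  · exact ht' h1
  · exact hSq t.2 h1

/-- Restriction of scalars along a localization `D → D'` preserves local `t`-linkedness. -/
theorem IsLocallyTLinked.restrictScalars [IsDomain D'] [Algebra D' A] [IsScalarTower D D' A]
    (S : Submonoid D) (hS : S ≤ nonZeroDivisors D) [IsLocalization S D']
    (hinj : Function.Injective (algebraMap D' A)) (h : IsLocallyTLinked D' A) :
    IsLocallyTLinked D A := by
  have injD : Function.Injective (algebraMap D D') := IsLocalization.injective D' hS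
  have injA : Function.Injective (algebraMap D A) := by
    rw [IsScalarTower.algebraMap_eq D D' A]; exact hinj.comp injD
  have : IsLocalization (Algebra.algebraMapSubmonoid D S) D' := by
    rwa [Algebra.algebraMapSubmonoid_self]
  rw [isLocallyTLinked_iff hinj] at h
  rw [isLocallyTLinked_iff injA]
  intro q hq s hs hn hd e f hf hdvd
  have hunit : ∀ u ∈ S, IsUnit (algebraMap D A u) := fun u hu => by
    rw [IsScalarTower.algebraMap_apply D D' A]
    exact (IsLocalization.map_units D' (⟨u, hu⟩ : S)).map _
  by_contra! hcon
  have haq : dvdIdeal D f e ≤ q := fun d hd' => by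
    by_contra hdq
    exact hcon d hdq (by simpa using mem_dvdIdeal.1 hd')
  -- The prime q may meet S and then does not extend to a prime of D'. As S consists of units of A,
  -- the ideal avoids S·(D ∖ q) and so lies in a prime r inside q that is disjoint from S; local
  -- `t`-linkedness is applied at the extension of r.
  have hdisj : Disjoint (dvdIdeal D f e : Set D) ↑(S ⊔ q.primeCompl) := by
    rw [Set.disjoint_left]
    intro d hd' hd''
    obtain ⟨u, hu, v, hv, rfl⟩ := Submonoid.mem_sup.1 hd''
    refine hv (haq ?_)
    rw [SetLike.mem_coe, mem_dvdIdeal, map_mul, mul_assoc, (hunit u hu).dvd_mul_left] at hd'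
    exact hd'
  obtain ⟨r, hr, har, hrd⟩ := Ideal.exists_le_prime_disjoint _ _ hdisj
  have hrS : Disjoint (S : Set D) r :=
    (hrd.mono_right (show (S : Set D) ⊆ ↑(S ⊔ q.primeCompl) from
      (le_sup_left : S ≤ S ⊔ q.primeCompl))).symm
  have hrq : q.primeCompl ≤ r.primeCompl := fun t ht htr =>
    Set.disjoint_left.1 hrd htr ((le_sup_right : _ ≤ S ⊔ q.primeCompl) ht)
  have hr' := IsLocalization.isPrime_of_isPrime_disjoint S D' r hr hrS
  have hrr : (r.map (algebraMap D D')).comap (algebraMap D D') = r :=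
    IsLocalization.under_map_of_isPrime_disjoint S D' hr hrS
  generalize r.map (algebraMap D D') = r' at hr' hrr
  subst hrr
  obtain ⟨hSr, h₁, h₂⟩ := primeCompl_comap_compat S r'
  have hd1 := (divClosureAt_image_iff (B := D) (B' := D') S injD hSr h₁ h₂ hs).2
    (hd.mono_submonoid hrq)
  rw [map_one] at hd1
  obtain ⟨a, ha, ha0⟩ := hn
  obtain ⟨t', ht', hdv⟩ := h r' _ (hs.image _) ⟨_, ⟨a, ha, rfl⟩, (map_ne_zero_iff _ injD).2 ha0⟩ hd1
    e f hf (by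
      rintro _ ⟨b, hb, rfl⟩
      rw [← IsScalarTower.algebraMap_apply]
      exact hdvd b hb)
  obtain ⟨⟨d, t⟩, hdt⟩ := IsLocalization.surj S t'
  -- The numerator of t' lies in the ideal, hence in r, although t' lies outside the extension of r.
  have hdr : d ∈ dvdIdeal D f e := by
    rw [mem_dvdIdeal, IsScalarTower.algebraMap_apply D D' A, ← hdt, map_mul, mul_right_comm]
    rw [mul_one] at hdv
    exact hdv.mul_right _
  have : t' * algebraMap D D' t ∈ r' := by rw [hdt]; exact har hdr
  rcases hr'.mem_or_mem this with h1 | h1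
  · exact ht' h1
  · exact hSr t.2 h1

/-- Local `t`-linkedness is preserved by localization. -/
theorem IsLocallyTLinked.localization {A' : Type*} [IsDomain D'] [CommRing A'] [IsDomain A']
    [Algebra A A'] [Algebra D A'] [Algebra D' A'] [IsScalarTower D A A'] [IsScalarTower D D' A']
    (S : Submonoid D) (hS : S ≤ nonZeroDivisors D) [IsLocalization S D']
    [IsLocalization (Algebra.algebraMapSubmonoid A S) A']
    (hinj : Function.Injective (algebraMap D A)) (h : IsLocallyTLinked D A) :
    IsLocallyTLinked D' A' := by
  rw [isLocallyTLinked_iff hinj] at h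
  rw [isLocallyTLinked_iff (algebraMap_localization_injective S hS hinj)]
  intro q hq
  have : (q.comap (algebraMap D D')).IsPrime := Ideal.comap_isPrime _ _
  obtain ⟨hSq, h₁, h₂⟩ := primeCompl_comap_compat S q
  exact (tLinkedAt_localization_iff S hS
    (IsLocalization.injective _ (algebraMapSubmonoid_le_nonZeroDivisors hinj hS)) hSq h₁ h₂).2
    (h (q.comap (algebraMap D D')))

end LocallyTLinked

/-! ### Integer-valued polynomials over arbitrary fraction fields -/

section IntOn

theorem eval_map_apply_ringHom {L L' : Type*} [CommRing L] [CommRing L'] (ψ : L →+* L') (f : L[X])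
    (x : L) : (f.map ψ).eval (ψ x) = ψ (f.eval x) := by
  rw [eval_map, eval₂_at_apply]

/-- Polynomial regularity of `D → A` with respect to chosen fraction fields `K → L`. -/
def IsPolyRegularIn (D A : Type*) {K L : Type*} [CommRing D] [CommRing A] [Algebra D A] [CommRing K]
    [CommRing L] [Algebra D K] [Algebra A L] (φ : K →+* L) : Prop :=
  ∀ f ∈ IntOn A L (Set.range fun d : D => algebraMap A L (algebraMap D A d)),
    f ∈ Submodule.span A (Polynomial.map φ '' (IntOn D K (Set.range (algebraMap D K)) : Set K[X]))

variable {D A : Type*} [CommRing D] [CommRing A] [Algebra D A]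

/-- Frees regularity from the choice of fraction fields, so that D and its localizations can share
one field K. -/
theorem IsPolyRegularIn.congr {K L K' L' : Type*} [CommRing K] [CommRing L] [CommRing K']
    [CommRing L'] [Algebra D K] [Algebra A L] [Algebra D K'] [Algebra A L'] {φ : K →+* L}
    {φ' : K' →+* L'} (σ : L ≃ₐ[A] L') (τ : K ≃ₐ[D] K') (hστ : ∀ x, σ (φ x) = φ' (τ x))
    (h : IsPolyRegularIn D A φ) : IsPolyRegularIn D A φ' := by
  intro f hf
  have h1 : f.map (σ.symm : L' →+* L) ∈
      IntOn A L (Set.range fun d : D => algebraMap A L (algebraMap D A d)) := by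
    rintro _ ⟨d, rfl⟩
    obtain ⟨a, ha⟩ := hf _ ⟨d, rfl⟩
    refine ⟨a, ?_⟩
    have := eval_map_apply_ringHom (σ.symm : L' →+* L) f (algebraMap A L' (algebraMap D A d))
    simp only [RingHom.coe_coe, AlgEquiv.commutes, ← ha] at this
    exact this.symm
  have h2 := Submodule.mem_map_of_mem (f := (Polynomial.mapAlgHom (σ : L →ₐ[A] L')).toLinearMap)
    (h _ h1)
  rw [Submodule.map_span] at h2
  have h3 : (Polynomial.mapAlgHom (σ : L →ₐ[A] L')).toLinearMap (f.map (σ.symm : L' →+* L)) = f := by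
    ext n
    simp
  rw [h3] at h2
  refine Submodule.span_mono ?_ h2
  rintro _ ⟨_, ⟨g, hg, rfl⟩, rfl⟩
  refine ⟨g.map (τ : K →+* K'), ?_, ?_⟩
  · rintro _ ⟨d, rfl⟩
    obtain ⟨a, ha⟩ := hg _ ⟨d, rfl⟩
    refine ⟨a, ?_⟩
    have := eval_map_apply_ringHom (τ : K →+* K') g (algebraMap D K d)
    simp only [RingHom.coe_coe, AlgEquiv.commutes, ← ha] at this
    exact this.symm
  · ext n
    simp [hστ]

theorem smul_eq_C_mul_algebraMap {L : Type*} [CommRing L] [Algebra A L] (a : A) (f : L[X]) :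
    a • f = C (algebraMap A L a) * f := by
  rw [Algebra.smul_def, Polynomial.algebraMap_apply]

/-- The inclusion of A·Int(D) in Int(D, A) always holds, so only the other one carries content. -/
theorem isPolynomiallyRegular_iff_fractionRing [IsDomain A]
    (h : Function.Injective (algebraMap D A)) :
    IsPolynomiallyRegular D A h ↔ IsPolyRegularIn D A
      (IsFractionRing.map h : FractionRing D →+* FractionRing A) := by
  refine ⟨fun h' f hf => ?_, fun h' => le_antisymm (fun f hf => h' f hf) ?_⟩
  · have : f ∈ Subalgebra.toSubmodule (IntExt D A) := hf
    rw [h'] at this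
    exact this
  · rw [Submodule.span_le]
    rintro _ ⟨g, hg, rfl⟩ _ ⟨d, rfl⟩
    obtain ⟨a, ha⟩ := hg _ ⟨d, rfl⟩
    refine ⟨algebraMap D A a, ?_⟩
    have hm : ∀ x : D, (IsFractionRing.map h : FractionRing D →+* FractionRing A)
        (algebraMap D _ x) = algebraMap A _ (algebraMap D A x) := fun x => IsLocalization.map_eq _ x
    beta_reduce
    rw [← hm, ← hm, eval_map_apply_ringHom, ← ha]

theorem isPolynomiallyRegular_iff [IsDomain D] [IsDomain A]
    (h : Function.Injective (algebraMap D A)) {K L : Type*} [Field K] [Field L] [Algebra D K]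
    [Algebra A L] [IsFractionRing D K] [IsFractionRing A L] (φ : K →+* L)
    (hφ : ∀ d, φ (algebraMap D K d) = algebraMap A L (algebraMap D A d)) :
    IsPolynomiallyRegular D A h ↔ IsPolyRegularIn D A φ := by
  rw [isPolynomiallyRegular_iff_fractionRing]
  have key : ∀ x, FractionRing.algEquiv A L ((IsFractionRing.map h :
      FractionRing D →+* FractionRing A) x) = φ (FractionRing.algEquiv D K x) := by
    intro x
    have : ((FractionRing.algEquiv A L : FractionRing A →+* L).comp (IsFractionRing.map h)) =
        φ.comp (FractionRing.algEquiv D K : FractionRing D →+* K) := by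
      refine IsLocalization.ringHom_ext (nonZeroDivisors D) (RingHom.ext fun d => ?_)
      have hm : (IsFractionRing.map h : FractionRing D →+* FractionRing A)
        (algebraMap D _ d) = algebraMap A _ (algebraMap D A d) := IsLocalization.map_eq _ d
      simp [hm, hφ]
    exact RingHom.congr_fun this x
  constructor
  · exact IsPolyRegularIn.congr (FractionRing.algEquiv A L) (FractionRing.algEquiv D K) key
  · refine IsPolyRegularIn.congr (FractionRing.algEquiv A L).symm (FractionRing.algEquiv D K).symm
      fun x => ?_
    rw [AlgEquiv.symm_apply_eq, key, AlgEquiv.apply_symm_apply]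

end IntOn

/-! ### Values on a localization, and interpolation -/

section Evaluation

/-- Induction on a degree bound: sⁿ f(X) − f(sX) has no term in Xⁿ and still maps E into R. At x/s
its value is sⁿ f(x/s) − f(x), and s is a unit of R. -/
theorem eval_mul_inv_mem {L : Type*} [Field L] (R E : Subring L) {s : L} (hsE : s ∈ E) (hs0 : s ≠ 0)
    (hsR : s ∈ R) (hsR' : s⁻¹ ∈ R) (f : L[X]) (hf : ∀ x ∈ E, f.eval x ∈ R) :
    ∀ x ∈ E, f.eval (x * s⁻¹) ∈ R := by
  suffices H : ∀ n : ℕ, ∀ f : L[X], f.degree < n → (∀ x ∈ E, f.eval x ∈ R) →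
      ∀ x ∈ E, f.eval (x * s⁻¹) ∈ R from
    H (f.natDegree + 1) f (by
      exact_mod_cast lt_of_le_of_lt degree_le_natDegree (by exact_mod_cast Nat.lt_succ_self _)) hf
  intro n
  induction n with
  | zero =>
    intro f hf _ x _
    have : f = 0 := by simpa using hf
    rw [this, eval_zero]
    exact zero_mem _
  | succ n ih =>
    intro f hdeg hf x hx
    have h1 : (C (s ^ n) * f - f.comp (C s * X)).degree < n := by
      rw [degree_lt_iff_coeff_zero]
      intro m hm
      rw [coeff_sub, coeff_C_mul, comp_C_mul_X_coeff]
      rcases hm.eq_or_lt with rfl | hm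
      · ring
      · rw [(degree_lt_iff_coeff_zero _ _).1 hdeg m hm]
        ring
    have h2 := ih _ h1 (fun y hy => by
      rw [eval_sub, eval_mul, eval_C, eval_comp, eval_mul, eval_C, eval_X]
      exact sub_mem (mul_mem (pow_mem hsR _) (hf y hy)) (hf _ (mul_mem hsE hy))) x hx
    rw [eval_sub, eval_mul, eval_C, eval_comp, eval_mul, eval_C, eval_X] at h2
    have h3 : s * (x * s⁻¹) = x := by field_simp
    rw [h3] at h2
    have h4 := mul_mem (pow_mem hsR' n) (add_mem h2 (hf x hx))
    rwa [sub_add_cancel, inv_pow, inv_mul_cancel_left₀ (pow_ne_zero _ hs0)] at h4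

theorem mem_intOn_localization {D D' A L : Type*} [CommRing D] [CommRing D'] [CommRing A] [Field L]
    [Algebra D D'] [Algebra D' A] [Algebra D A] [IsScalarTower D D' A] [Algebra A L]
    (S : Submonoid D) [IsLocalization S D'] {f : L[X]}
    (hf : f ∈ IntOn A L (Set.range fun d : D => algebraMap A L (algebraMap D A d))) :
    f ∈ IntOn A L (Set.range fun d : D' => algebraMap A L (algebraMap D' A d)) := by
  rintro _ ⟨d', rfl⟩
  obtain ⟨⟨d, s⟩, h⟩ := IsLocalization.surj S d'
  have hu : IsUnit (algebraMap D A s) := by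
    rw [IsScalarTower.algebraMap_apply D D' A]
    exact (IsLocalization.map_units D' s).map _
  have hu' : IsUnit (algebraMap A L (algebraMap D A s)) := hu.map _
  have h' := congrArg (algebraMap A L) (congrArg (algebraMap D' A) h)
  rw [map_mul, map_mul, ← IsScalarTower.algebraMap_apply D D' A,
    ← IsScalarTower.algebraMap_apply D D' A] at h'
  have h3 : algebraMap A L (algebraMap D' A d') =
      algebraMap A L (algebraMap D A d) * (algebraMap A L (algebraMap D A s))⁻¹ := by
    rw [← h', mul_inv_cancel_right₀ hu'.ne_zero]
  beta_reduce
  rw [h3]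
  refine eval_mul_inv_mem (algebraMap A L).range ((algebraMap A L).comp (algebraMap D A)).range
    ⟨s, rfl⟩ hu'.ne_zero ⟨_, rfl⟩ ?_ f ?_ _ ⟨d, rfl⟩
  · obtain ⟨u, hu⟩ := hu
    refine ⟨(u⁻¹ : Aˣ), eq_inv_of_mul_eq_one_left ?_⟩
    rw [RingHom.comp_apply, ← hu, ← map_mul, Units.inv_mul, map_one]
  · rintro _ ⟨x, rfl⟩
    exact hf _ ⟨x, rfl⟩

/-- If `D ⧸ p` is infinite, then polynomials mapping `D` to `A` have coefficients in `A` locally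
at `p`. -/
theorem exists_C_mul_eq_map {D A L : Type*} [CommRing D] [CommRing A] [Field L] [Algebra D A]
    [Algebra A L] (hinj : Function.Injective fun d : D => algebraMap A L (algebraMap D A d))
    (p : Ideal D) [hp : p.IsPrime] [Infinite (D ⧸ p)] {f : L[X]}
    (hf : f ∈ IntOn A L (Set.range fun d : D => algebraMap A L (algebraMap D A d))) :
    ∃ s ∉ p, ∃ F : A[X], C (algebraMap A L (algebraMap D A s)) * f = F.map (algebraMap A L) := by
  classical
  let ι : D →+* L := (algebraMap A L).comp (algebraMap D A)
  choose v hv using fun n => Ideal.Quotient.mk_surjective (I := p) (Infinite.natEmbedding (D ⧸ p) n)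
  have hvp : ∀ i j, i ≠ j → v i - v j ∉ p := fun i j hij hmem =>
    hij ((Infinite.natEmbedding (D ⧸ p)).injective (by
      rw [← hv, ← hv]; exact (Ideal.Quotient.mk_eq_mk_iff_sub_mem _ _).2 hmem))
  have hvι : ∀ i j, i ≠ j → ι (v i) - ι (v j) ≠ 0 := fun i j hij h0 =>
    hvp i j hij (by rw [sub_eq_zero.1 (show v i - v j = 0 from hinj (by
      simpa [ι] using h0))] ; simp)
  set N := Finset.range (f.natDegree + 1) with hN
  have hinterp : f = Lagrange.interpolate N (fun i => ι (v i)) fun i => f.eval (ι (v i)) := by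
    refine Lagrange.eq_interpolate (fun i _ j _ hij => ?_) ?_
    · by_contra hne
      exact hvι i j hne (sub_eq_zero.2 hij)
    · rw [hN, Finset.card_range]
      exact lt_of_le_of_lt degree_le_natDegree (by exact_mod_cast Nat.lt_succ_self _)
  -- The denominator of the i-th Lagrange basis polynomial; it lies outside p because the nodes are
  -- pairwise incongruent modulo p.
  let P : ℕ → D := fun i => ∏ j ∈ N.erase i, (v i - v j)
  refine ⟨∏ i ∈ N, P i, fun hmem => ?_, ?_⟩
  · obtain ⟨i, -, hi⟩ := (Ideal.IsPrime.prod_mem_iff).1 hmem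
    obtain ⟨j, hj, hj'⟩ := (Ideal.IsPrime.prod_mem_iff).1 hi
    exact hvp i j (Finset.ne_of_mem_erase hj).symm hj'
  · suffices C (ι (∏ i ∈ N, P i)) * f ∈ (mapRingHom (algebraMap A L)).range by
      obtain ⟨F, hF⟩ := this
      exact ⟨F, hF.symm⟩
    have hC : ∀ d : D, C (ι d) ∈ (mapRingHom (algebraMap A L)).range :=
      fun d => ⟨C (algebraMap D A d), by simp [ι]⟩
    rw [hinterp, Lagrange.interpolate_apply, Finset.mul_sum]
    refine sum_mem fun i hi => ?_
    rw [← Finset.mul_prod_erase N P hi, map_mul, C_mul]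
    obtain ⟨a, ha⟩ := hf _ ⟨v i, rfl⟩
    have hb : C (ι (P i)) * Lagrange.basis N (fun i => ι (v i)) i =
        ∏ j ∈ N.erase i, (X - C (ι (v j))) := by
      rw [Lagrange.basis, map_prod, map_prod, ← Finset.prod_mul_distrib]
      refine Finset.prod_congr rfl fun j hj => ?_
      rw [Lagrange.basisDivisor, ← mul_assoc, ← C_mul, map_sub,
        mul_inv_cancel₀ (hvι i j (Finset.ne_of_mem_erase hj).symm), C_1, one_mul]
    have : C (ι (P i)) * C (ι (∏ x ∈ N.erase i, P x)) *
        (C (f.eval (ι (v i))) * Lagrange.basis N (fun i => ι (v i)) i) =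
        C (ι (∏ x ∈ N.erase i, P x)) * C (f.eval (ι (v i))) *
          ∏ j ∈ N.erase i, (X - C (ι (v j))) := by
      rw [← hb]; ring
    rw [this]
    refine mul_mem (mul_mem (hC _) ⟨C a, ?_⟩) (prod_mem fun j _ => sub_mem ⟨X, by simp⟩ (hC _))
    rw [coe_mapRingHom, map_C, ha]
    rfl

theorem map_mem_span_intOn {D A K L : Type*} [CommRing D] [CommRing A] [CommRing K] [CommRing L]
    [Algebra D K] [Algebra A L] (φ : K →+* L) (F : A[X]) :
    F.map (algebraMap A L) ∈ Submodule.span A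
      (Polynomial.map φ '' (IntOn D K (Set.range (algebraMap D K)) : Set K[X])) := by
  rw [as_sum_range_C_mul_X_pow F, Polynomial.map_sum]
  refine sum_mem fun i _ => ?_
  rw [Polynomial.map_mul, Polynomial.map_pow, map_C, map_X, ← smul_eq_C_mul_algebraMap]
  refine Submodule.smul_mem _ _ (Submodule.subset_span ⟨X ^ i, ?_, by simp⟩)
  rintro _ ⟨d, rfl⟩
  exact ⟨d ^ i, by simp⟩

end Evaluation

/-! ### Primes that are not `t`-localizing -/

section NonLocalizing

variable {D : Type*} [CommRing D]

/-- By `H`, locally at p no prime other than p itself can contain the denominator ideal, so its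
radical contains s. A power of the finitely generated ideal J spanned by s then lies in it, and the
exponent descends to 0 because J has trivial v-closure. -/
theorem not_dvdIdeal_le_of_divClosureAt {A : Type*} [CommRing A] [Algebra D A]
    {p : Ideal D} [hp : p.IsPrime] {s : Set D} (hs : s.Finite) (hsp : s ⊆ p)
    (hd : DivClosureAt p.primeCompl A s 1) {b e : A} (hb : b ≠ 0)
    (H : ∀ q : Ideal D, q.IsPrime → q ≤ p → q ≠ p → ¬ dvdIdeal D b e ≤ q) :
    ¬ dvdIdeal D b e ≤ p := by
  -- The saturation of the denominator ideal with respect to D ∖ p.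
  let 𝔠 : Ideal D :=
    { carrier := {d | ∃ u ∈ p.primeCompl, u * d ∈ dvdIdeal D b e}
      add_mem' := by
        rintro x y ⟨u, hu, hx⟩ ⟨w, hw, hy⟩
        refine ⟨u * w, mul_mem hu hw, ?_⟩
        have : u * w * (x + y) = w * (u * x) + u * (w * y) := by ring
        rw [this]
        exact add_mem (Ideal.mul_mem_left _ _ hx) (Ideal.mul_mem_left _ _ hy)
      zero_mem' := ⟨1, one_mem _, by simp⟩
      smul_mem' := by
        rintro r x ⟨u, hu, hx⟩
        refine ⟨u, hu, ?_⟩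
        rw [smul_eq_mul, mul_left_comm]
        exact Ideal.mul_mem_left _ _ hx }
  have hrad : Ideal.span s ≤ 𝔠.radical := by
    rw [Ideal.span_le]
    intro a ha
    by_contra hna
    have hdisj : Disjoint (dvdIdeal D b e : Set D) ↑(p.primeCompl ⊔ Submonoid.powers a) := by
      rw [Set.disjoint_left]
      intro d hd' hd''
      obtain ⟨u, hu, _, ⟨n, rfl⟩, rfl⟩ := Submonoid.mem_sup.1 hd''
      exact hna ⟨n, u, hu, hd'⟩
    obtain ⟨q, hq, hle, hqd⟩ := Ideal.exists_le_prime_disjoint _ _ hdisj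
    refine H q hq (fun x hx => ?_) ?_ hle
    · by_contra hxp
      exact Set.disjoint_left.1 hqd hx ((le_sup_left : p.primeCompl ≤ _) hxp)
    · rintro rfl
      exact Set.disjoint_left.1 hqd (hsp ha)
        ((le_sup_right : _ ≤ q.primeCompl ⊔ _) (Submonoid.mem_powers a))
  obtain ⟨n, hn⟩ := Ideal.exists_pow_le_of_le_radical_of_fg hrad (Submodule.fg_span hs)
  -- For x in Jᵏ, all products a x with a in s lie in 𝔠; the divisorial condition on s then puts x
  -- itself in 𝔠.
  have step : ∀ n, Ideal.span s ^ n ≤ 𝔠 → (1 : D) ∈ 𝔠 := by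
    intro n
    induction n with
    | zero => exact fun h => h (by simp)
    | succ k ih =>
      refine fun h => ih fun x hx => ?_
      obtain ⟨w, hw, h1⟩ := exists_common_mem_dvd (S := p.primeCompl) (f := b)
        (e := fun a => algebraMap D A (a * x) * e) hs fun a ha => by
          obtain ⟨u, hu, h2⟩ := h (show a * x ∈ _ by
            rw [pow_succ']; exact Ideal.mul_mem_mul (Ideal.subset_span ha) hx)
          refine ⟨u, hu, ?_⟩
          rw [mem_dvdIdeal, map_mul, mul_assoc] at h2
          exact h2
      obtain ⟨t, ht, h3⟩ := hd (algebraMap D A (w * x) * e) b hb fun a ha => by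
        convert h1 a ha using 1
        simp only [map_mul]; ring
      refine ⟨t * w, mul_mem ht hw, ?_⟩
      rw [mem_dvdIdeal]
      convert h3 using 1
      simp only [map_mul, map_one]; ring
  obtain ⟨u, hu, h1⟩ := step n hn
  rw [mul_one] at h1
  exact fun hle => hu (hle h1)

variable [IsDomain D] {p : Ideal D} [hp : p.IsPrime]

theorem divClosureAt_primeCompl_iff {s : Set D} (hs : s.Finite) {c : D} :
    DivClosureAt (⊥ : Submonoid (Localization.AtPrime p)) (Localization.AtPrime p)
      (algebraMap D _ '' s) (algebraMap D _ c) ↔ DivClosureAt p.primeCompl D s c := by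
  have : IsLocalization (Algebra.algebraMapSubmonoid D p.primeCompl) (Localization.AtPrime p) := by
    rw [Algebra.algebraMapSubmonoid_self]; infer_instance
  exact divClosureAt_image_iff p.primeCompl
    (IsLocalization.injective _ p.primeCompl_le_nonZeroDivisors) le_rfl
    (fun t ht => ⟨1, rfl, (IsLocalization.map_units _ (⟨t, ht⟩ : p.primeCompl)).dvd⟩)
    (fun t' ht' => ⟨1, one_mem _, by rw [Submonoid.mem_bot.1 ht']; exact one_dvd _⟩) hs

theorem IsTLocalizing.isTIdeal (h : IsTLocalizing p) : IsTIdeal p := by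
  obtain ⟨h0, h⟩ := isTIdeal_iff.1 h
  refine isTIdeal_iff.2 ⟨fun hbot => h0 ((Ideal.map_eq_bot_iff_of_injective
    (IsLocalization.injective _ p.primeCompl_le_nonZeroDivisors)).2 hbot), ?_⟩
  rintro s hs hf ⟨a, ha, ha0⟩ c hc
  have h1 := h (algebraMap D _ '' s) (by
      rintro _ ⟨b, hb, rfl⟩; exact Ideal.mem_map_of_mem _ (hs hb)) (hf.image _)
    ⟨_, ⟨a, ha, rfl⟩, (map_ne_zero_iff _
      (IsLocalization.injective _ p.primeCompl_le_nonZeroDivisors)).2 ha0⟩ _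
    ((divClosureAt_primeCompl_iff hf).2 (hc.mono_submonoid bot_le))
  rw [Localization.AtPrime.map_eq_maximalIdeal] at h1
  exact (IsLocalization.AtPrime.to_map_mem_maximal_iff (Localization.AtPrime p) p c).1 h1

theorem exists_divClosureAt_of_not_isTLocalizing (hp0 : p ≠ ⊥) (h : ¬ IsTLocalizing p) :
    ∃ s : Set D, s.Finite ∧ s ⊆ p ∧ (∃ a ∈ s, a ≠ 0) ∧ DivClosureAt p.primeCompl D s 1 := by
  have inj := IsLocalization.injective (Localization.AtPrime p) p.primeCompl_le_nonZeroDivisors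
  rw [IsTLocalizing, isTIdeal_iff, not_and] at h
  have h := h fun h0 => hp0 ((Ideal.map_eq_bot_iff_of_injective inj).1 h0)
  push Not at h
  obtain ⟨s', hs', hf', ⟨a, ha, ha0⟩, c, hc, hcm⟩ := h
  obtain ⟨s, hs, h1, h2⟩ := exists_finite_image_span_eq p.primeCompl hf'
  rw [Localization.AtPrime.map_eq_maximalIdeal] at hs' hcm
  -- An element of the v-closure outside the maximal ideal of D_p is a unit, so 1 is in the
  -- v-closure too.
  have hcu : IsUnit c := by simpa using hcm
  refine ⟨s, hs, fun b hb => ?_, ?_, ?_⟩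
  · exact (IsLocalization.AtPrime.to_map_mem_maximal_iff (Localization.AtPrime p) p b).1
      (Ideal.span_le.2 hs' (h2 ⟨b, hb, rfl⟩))
  · by_contra! h0
    refine ha0 ?_
    have : Ideal.span (algebraMap D (Localization.AtPrime p) '' s) = ⊥ := by
      rw [Ideal.span_eq_bot]
      rintro _ ⟨b, hb, rfl⟩
      rw [h0 b hb, map_zero]
    simpa [this] using h1 ha
  · rw [← divClosureAt_primeCompl_iff hs, map_one]
    intro e f hf hdvd
    obtain ⟨t, ht, h3⟩ := hc.mono_of_subset_span h1 e f hf hdvd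
    refine ⟨t, ht, ?_⟩
    rw [map_mul, mul_right_comm, Algebra.algebraMap_self_apply c, hcu.dvd_mul_right] at h3
    rwa [mul_one]

end NonLocalizing

/-! ### Polynomial regularity and localization -/

section Main

theorem mem_localization_subalgebra_iff {D D' K : Type*} [CommRing D] [CommRing D'] [Field K]
    [Algebra D K] [IsFractionRing D K] [Algebra D D'] [Algebra D' K] [IsScalarTower D D' K]
    (S : Submonoid D) (hS : S ≤ nonZeroDivisors D) [IsLocalization S D'] {x : K} :
    x ∈ Localization.subalgebra K S hS ↔ x ∈ (algebraMap D' K).range := by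
  have key : ∀ (d : D) (t : S), algebraMap D' K (IsLocalization.mk' D' d t) =
      IsLocalization.mk' K d ⟨t, hS t.2⟩ := fun d t => by
    rw [eq_comm, IsLocalization.mk'_eq_iff_eq_mul, IsScalarTower.algebraMap_apply D D' K,
      IsScalarTower.algebraMap_apply D D' K, ← map_mul, IsLocalization.mk'_spec]
  constructor
  · rintro ⟨d, t, ht, rfl⟩
    exact ⟨IsLocalization.mk' D' d ⟨t, ht⟩, key _ _⟩
  · rintro ⟨y, rfl⟩
    obtain ⟨d, t, rfl⟩ := IsLocalization.exists_mk'_eq S y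
    exact ⟨d, t, t.2, key d t⟩

/-- Only finitely many coefficients from A' occur, so a single element of S clears their
denominators. -/
theorem exists_smul_mem_span_of_mem_span {D A A' L : Type*} [CommRing D] [CommRing A] [CommRing A']
    [CommRing L] [Algebra D A] [Algebra A A'] [Algebra D A'] [IsScalarTower D A A'] [Algebra A L]
    [Algebra A' L] [IsScalarTower A A' L] (S : Submonoid D)
    [IsLocalization (Algebra.algebraMapSubmonoid A S) A'] {G H : Set L[X]}
    (hG : ∀ g ∈ G, ∃ s ∈ S, algebraMap D A s • g ∈ Submodule.span A H) {f : L[X]}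
    (hf : f ∈ Submodule.span A' G) : ∃ s ∈ S, algebraMap D A s • f ∈ Submodule.span A H := by
  induction hf using Submodule.span_induction with
  | mem x hx => exact hG x hx
  | zero => exact ⟨1, one_mem _, by simp⟩
  | add x y _ _ hx hy =>
    obtain ⟨s, hs, hx⟩ := hx
    obtain ⟨t, ht, hy⟩ := hy
    refine ⟨s * t, mul_mem hs ht, ?_⟩
    rw [map_mul, smul_add]
    refine add_mem ?_ ?_
    · rw [mul_comm, mul_smul]
      exact Submodule.smul_mem _ _ hx
    · rw [mul_smul]
      exact Submodule.smul_mem _ _ hy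
  | smul r x _ hx =>
    obtain ⟨s, hs, hx⟩ := hx
    obtain ⟨t, ht, a, ha⟩ := exists_mul_eq_algebraMap S (B := A) r
    refine ⟨t * s, mul_mem ht hs, ?_⟩
    have : algebraMap D A (t * s) • r • x = a • algebraMap D A s • x := by
      simp only [smul_eq_C_mul_algebraMap]
      rw [IsScalarTower.algebraMap_apply A A' L a, ← ha, IsScalarTower.algebraMap_apply D A A',
        map_mul (algebraMap A' L), ← IsScalarTower.algebraMap_apply A A' L, map_mul, map_mul, C_mul,
        C_mul]
      ring
    rw [this]
    exact Submodule.smul_mem _ _ hx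

theorem IsPolynomiallyLTRegular.isPolynomiallyLRegular {D : Type u} [CommRing D] [IsDomain D]
    (h : IsPolynomiallyLTRegular D) : IsPolynomiallyLRegular D := by
  intro S hS
  let K := FractionRing D
  let B := Localization.subalgebra K S hS
  have injB : Function.Injective (algebraMap D B) := IsLocalization.injective B hS
  have hreg := (isPolynomiallyRegular_iff injB (K := K) (L := K) (RingHom.id K) fun d => rfl).1
    (h B injB (isLocallyTLinked_localization S hS))
  have hB : ∀ x : K, x ∈ (algebraMap B K).range ↔ x ∈ B := fun x =>
    ⟨by rintro ⟨y, rfl⟩; exact y.2, fun hx => ⟨⟨x, hx⟩, rfl⟩⟩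
  ext f
  constructor
  · intro hf
    have h1 := hreg f (by
      rintro _ ⟨d, rfl⟩
      exact hf _ (algebraMap D B d).2)
    have : IsLocalization (Algebra.algebraMapSubmonoid D S) B := by
      rw [Algebra.algebraMapSubmonoid_self]; infer_instance
    have h2 := exists_smul_mem_span_of_mem_span (A := D) (H := (IntRing D : Set K[X])) S (by
      rintro _ ⟨g, hg, rfl⟩
      refine ⟨1, one_mem _, ?_⟩
      rw [map_one, one_smul, Polynomial.map_id]
      exact Submodule.subset_span hg) h1
    rw [← Subalgebra.coe_toSubmodule, Submodule.span_eq] at h2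
    exact h2
  · rintro ⟨s, hs, hf⟩
    have hs0 : algebraMap D K s ≠ 0 := by
      simpa using nonZeroDivisors.ne_zero (hS hs)
    -- This inclusion needs no regularity: `mem_intOn_localization` extends integrality from D to
    -- S⁻¹D.
    have h1 : f ∈ IntOn B K (Set.range fun d : D => algebraMap B K (algebraMap D B d)) := by
      rintro _ ⟨d, rfl⟩
      obtain ⟨a, ha⟩ := hf _ ⟨d, rfl⟩
      refine (hB _).2 ⟨a, s, hs, ?_⟩
      rw [eq_comm, IsLocalization.mk'_eq_iff_eq_mul, ha, smul_eq_C_mul_algebraMap, eval_mul, eval_C,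
        mul_comm]
      rfl
    have h2 := mem_intOn_localization (D' := B) S h1
    intro x hx
    exact h2 x ⟨⟨x, hx⟩, rfl⟩

/-- Over D the same A is still locally `t`-linked, Int(D', A) lies in Int(D, A), and Int(D) lies in
Int(D'), so generation by Int(D) gives generation by Int(D'). -/
theorem IsPolynomiallyLTRegular.localization {D D' : Type u} [CommRing D] [IsDomain D]
    [CommRing D'] [IsDomain D'] [Algebra D D'] (S : Submonoid D) (hS : S ≤ nonZeroDivisors D)
    [IsLocalization S D'] (h : IsPolynomiallyLTRegular D) : IsPolynomiallyLTRegular D' := by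
  intro A _ _ _ hinj hA
  let _ : Algebra D A := ((algebraMap D' A).comp (algebraMap D D')).toAlgebra
  have : IsScalarTower D D' A := IsScalarTower.of_algebraMap_eq fun _ => rfl
  have injD : Function.Injective (algebraMap D D') := IsLocalization.injective D' hS
  have injA : Function.Injective (algebraMap D A) := hinj.comp injD
  have hφ : ∀ d, (IsFractionRing.map hinj : FractionRing D' →+* FractionRing A)
      (algebraMap D' _ d) = algebraMap A _ (algebraMap D' A d) := IsLocalization.map_eq _
  have hι : ∀ d, (IsFractionRing.map injD : FractionRing D →+* FractionRing D')
      (algebraMap D _ d) = algebraMap D' _ (algebraMap D D' d) := IsLocalization.map_eq _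
  have hreg := (isPolynomiallyRegular_iff injA
    ((IsFractionRing.map hinj : FractionRing D' →+* FractionRing A).comp
      (IsFractionRing.map injD : FractionRing D →+* FractionRing D')) fun d => by
        rw [RingHom.comp_apply, hι, hφ]; rfl).1 (h A injA (hA.restrictScalars S hS hinj))
  rw [isPolynomiallyRegular_iff_fractionRing]
  intro f hf
  refine Submodule.span_mono ?_ (hreg f (by
    rintro _ ⟨d, rfl⟩
    exact hf _ ⟨algebraMap D D' d, rfl⟩))
  rintro _ ⟨g, hg, rfl⟩
  refine ⟨g.map (IsFractionRing.map injD : FractionRing D →+* FractionRing D'), ?_,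
    Polynomial.map_map _ _ _⟩
  refine mem_intOn_localization (D := D) (D' := D') (A := D') S ?_
  rintro _ ⟨d, rfl⟩
  obtain ⟨a, ha⟩ := hg _ ⟨d, rfl⟩
  refine ⟨algebraMap D D' a, ?_⟩
  beta_reduce
  rw [← hι, ← hι, eval_map_apply_ringHom, ha]

/-- If each coefficient of `f` has a multiple by an element of `S` in `A`, then `f` has a multiple
by an element of `S` in `A[X]`. -/
theorem exists_C_mul_eq_map_of_coeff {D A L : Type*} [CommRing D] [CommRing A] [CommRing L]
    [Algebra D A] [Algebra A L] (S : Submonoid D) (f : L[X])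
    (h : ∀ n, ∃ s ∈ S, algebraMap A L (algebraMap D A s) * f.coeff n ∈ (algebraMap A L).range) :
    ∃ s ∈ S, ∃ F : A[X], C (algebraMap A L (algebraMap D A s)) * f = F.map (algebraMap A L) := by
  choose t ht hmem using h
  refine ⟨∏ i ∈ f.support, t i, prod_mem fun i _ => ht i, ?_⟩
  have : C (algebraMap A L (algebraMap D A (∏ i ∈ f.support, t i))) * f ∈
      Polynomial.lifts (algebraMap A L) := by
    rw [lifts_iff_coeff_lifts]
    intro n
    by_cases hn : n ∈ f.support
    · obtain ⟨a, ha⟩ := hmem n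
      rw [coeff_C_mul, ← Finset.mul_prod_erase _ _ hn, mul_comm (t n), map_mul, map_mul, mul_assoc,
        ← ha, ← map_mul]
      exact ⟨_, rfl⟩
    · rw [coeff_C_mul, notMem_support_iff.1 hn, mul_zero]
      exact ⟨0, map_zero _⟩
  obtain ⟨F, hF⟩ := (mem_lifts _).1 this
  exact ⟨F, hF.symm⟩

variable {D : Type u} [CommRing D] [IsDomain D]

theorem exists_C_mul_eq_map_of_not_isTLocalizing [Infinite D] {A L : Type*} [CommRing A] [IsDomain A]
    [Field L] [Algebra D A] [Algebra A L] [IsFractionRing A L]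
    (hinj : Function.Injective (algebraMap D A)) {p : Ideal D} [hp : p.IsPrime]
    [Finite (D ⧸ p)] (hpt : ¬ IsTLocalizing p) (hA : TLinkedAt p.primeCompl A) {f : L[X]}
    (hf : f ∈ IntOn A L (Set.range fun d : D => algebraMap A L (algebraMap D A d))) :
    ∃ s ∈ p.primeCompl, ∃ F : A[X],
      C (algebraMap A L (algebraMap D A s)) * f = F.map (algebraMap A L) := by
  have injL := IsFractionRing.injective A L
  have hp0 : p ≠ ⊥ := by
    rintro rfl
    exact not_finite_iff_infinite.2 ‹Infinite D›
      (Finite.of_equiv _ (RingEquiv.quotientBot D).toEquiv)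
  obtain ⟨s, hs, hsp, hn, hd⟩ := exists_divClosureAt_of_not_isTLocalizing hp0 hpt
  refine exists_C_mul_eq_map_of_coeff _ f fun n => ?_
  obtain ⟨e, b, hb, hc⟩ := IsFractionRing.div_surjective (A := A) (f.coeff n)
  have hb := nonZeroDivisors.ne_zero hb
  have hb' : algebraMap A L b ≠ 0 := (map_ne_zero_iff _ injL).2 hb
  have key : ∀ d : D, algebraMap A L (algebraMap D A d) * f.coeff n ∈ (algebraMap A L).range ↔
      d ∈ dvdIdeal D b e := by
    intro d
    rw [← hc, mem_dvdIdeal, mul_div_assoc', ← map_mul]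
    constructor
    · rintro ⟨x, hx⟩
      refine ⟨x, injL ?_⟩
      rw [map_mul _ b, hx, mul_div_cancel₀ _ hb']
    · rintro ⟨x, hx⟩
      exact ⟨x, by rw [hx, map_mul, mul_div_cancel_left₀ _ hb']⟩
  -- For q strictly below p the domain D/q is infinite, since a finite one would be a field and q
  -- would be maximal; interpolation at q then gives a denominator of the coefficient outside q.
  have h1 := not_dvdIdeal_le_of_divClosureAt hs hsp (hA s hs hn hd) (e := e) hb fun q hq hqp hne => by
    have : Infinite (D ⧸ q) := by
      rw [← not_finite_iff_infinite]
      intro hfin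
      have := Finite.isField_of_domain (D ⧸ q)
      exact hne ((Ideal.Quotient.maximal_of_isField q this).eq_of_le hp.ne_top hqp)
    obtain ⟨t, ht, F, hF⟩ := exists_C_mul_eq_map (injL.comp hinj) q hf
    refine fun hle => ht (hle ((key t).1 ?_))
    rw [← coeff_C_mul, hF, coeff_map]
    exact ⟨_, rfl⟩
  obtain ⟨t, ht, htp⟩ := SetLike.not_le_iff_exists.1 h1
  exact ⟨t, htp, (key t).2 ht⟩

theorem exists_smul_mem_span_of_localization {A : Type u} [CommRing A] [IsDomain A] [Algebra D A]
    (hinj : Function.Injective (algebraMap D A)) {L : Type*} [Field L] [Algebra A L]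
    [IsFractionRing A L] (φ : FractionRing D →+* L)
    (hφ : ∀ d, φ (algebraMap D _ d) = algebraMap A L (algebraMap D A d))
    (hL : IsPolynomiallyLRegular D) (hA : IsLocallyTLinked D A) {p : Ideal D} [hp : p.IsPrime]
    (hreg : IsPolynomiallyLTRegular (Localization.AtPrime p)) {f : L[X]}
    (hf : f ∈ IntOn A L (Set.range fun d : D => algebraMap A L (algebraMap D A d))) :
    ∃ s ∈ p.primeCompl, algebraMap D A s • f ∈ Submodule.span A (Polynomial.map φ ''
      (IntOn D (FractionRing D) (Set.range (algebraMap D (FractionRing D))) :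
        Set (FractionRing D)[X])) := by
  let K := FractionRing D
  let D' := Localization.AtPrime p
  let A' := Localization (Algebra.algebraMapSubmonoid A p.primeCompl)
  have hp0 := p.primeCompl_le_nonZeroDivisors
  have hA0 := algebraMapSubmonoid_le_nonZeroDivisors hinj hp0
  let _ : Algebra D' K := IsLocalization.localizationAlgebraOfSubmonoidLe D' K p.primeCompl _ hp0
  have : IsScalarTower D D' K :=
    IsLocalization.localization_isScalarTower_of_submonoid_le D' K p.primeCompl _ hp0
  let _ : Algebra A' L := IsLocalization.localizationAlgebraOfSubmonoidLe A' L
    (Algebra.algebraMapSubmonoid A p.primeCompl) _ hA0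
  have : IsScalarTower A A' L := IsLocalization.localization_isScalarTower_of_submonoid_le A' L
    (Algebra.algebraMapSubmonoid A p.primeCompl) _ hA0
  have : IsFractionRing D' K :=
    IsFractionRing.isFractionRing_of_isDomain_of_isLocalization p.primeCompl D' K
  have : IsFractionRing A' L := IsFractionRing.isFractionRing_of_isDomain_of_isLocalization
    (Algebra.algebraMapSubmonoid A p.primeCompl) A' L
  have : IsDomain A' := IsLocalization.isDomain_localization hA0
  have hAL : ∀ d : D, algebraMap A' L (algebraMap D A' d) = algebraMap A L (algebraMap D A d) :=
    fun d => by
      rw [IsScalarTower.algebraMap_apply D A A', ← IsScalarTower.algebraMap_apply A A' L]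
  have hφ' : ∀ d : D', φ (algebraMap D' K d) = algebraMap A' L (algebraMap D' A' d) := by
    intro d
    have : φ.comp (algebraMap D' K) = (algebraMap A' L).comp (algebraMap D' A') := by
      refine IsLocalization.ringHom_ext p.primeCompl (RingHom.ext fun d => ?_)
      simp only [RingHom.comp_apply]
      rw [← IsScalarTower.algebraMap_apply D D' K, hφ, ← IsScalarTower.algebraMap_apply D D' A', hAL]
    exact RingHom.congr_fun this d
  have inj' := algebraMap_localization_injective (D' := D') (A' := A') p.primeCompl hp0 hinj
  have h1 := (isPolynomiallyRegular_iff inj' φ hφ').1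
    (hreg A' inj' (hA.localization p.primeCompl hp0 hinj)) f
    (mem_intOn_localization (D := D) (D' := D') p.primeCompl (by
      rintro _ ⟨d, rfl⟩
      obtain ⟨a, ha⟩ := hf _ ⟨d, rfl⟩
      refine ⟨algebraMap A A' a, ?_⟩
      beta_reduce
      rw [hAL, ← ha, ← IsScalarTower.algebraMap_apply A A' L]))
  refine exists_smul_mem_span_of_mem_span (A' := A') p.primeCompl ?_ h1
  rintro _ ⟨g, hg, rfl⟩
  -- L-regularity at D ∖ p brings a generator from Int(D_p) into Int(D) after multiplication by some
  -- s outside p.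
  have h2 : g ∈ {f : K[X] | ∃ s ∈ p.primeCompl, s • f ∈ IntRing D} := by
    rw [← hL p.primeCompl hp0]
    intro x hx
    obtain ⟨y, rfl⟩ := (mem_localization_subalgebra_iff (D' := D') p.primeCompl hp0).1 hx
    exact ⟨⟨_, (mem_localization_subalgebra_iff (D' := D') p.primeCompl hp0).2
      (hg _ ⟨y, rfl⟩)⟩, rfl⟩
  obtain ⟨s, hs, hsg⟩ := h2
  refine ⟨s, hs, Submodule.subset_span ⟨_, hsg, ?_⟩⟩
  rw [smul_eq_C_mul_algebraMap, smul_eq_C_mul_algebraMap, Polynomial.map_mul, map_C, hφ]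

theorem IsPolynomiallyLRegular.isPolynomiallyLTRegular [Infinite D] (hL : IsPolynomiallyLRegular D)
    (H : ∀ (p : Ideal D) [p.IsPrime], IsTLocalizing p → IsTMaximal p → Finite p.ResidueField →
      IsPolynomiallyLTRegular (Localization.AtPrime p)) : IsPolynomiallyLTRegular D := by
  intro A _ _ _ hinj hA
  have hφ : ∀ d, (IsFractionRing.map hinj : FractionRing D →+* FractionRing A)
      (algebraMap D _ d) = algebraMap A _ (algebraMap D A d) := IsLocalization.map_eq _
  rw [isPolynomiallyRegular_iff_fractionRing]
  intro f hf
  set M := Submodule.span A (Polynomial.map (IsFractionRing.map hinj :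
    FractionRing D →+* FractionRing A) '' (IntOn D (FractionRing D)
      (Set.range (algebraMap D (FractionRing D))) : Set (FractionRing D)[X])) with hM
  let 𝔞 : Ideal D := Ideal.comap (algebraMap D A) (M.comap (LinearMap.toSpanSingleton A _ f))
  have h𝔞 : ∀ d, d ∈ 𝔞 ↔ algebraMap D A d • f ∈ M := fun d => Iff.rfl
  have of_map : ∀ s, (∃ F : A[X], C (algebraMap A (FractionRing A) (algebraMap D A s)) * f =
      F.map (algebraMap A _)) → s ∈ 𝔞 := by
    rintro s ⟨F, hF⟩
    rw [h𝔞, smul_eq_C_mul_algebraMap, hF]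
    exact map_mem_span_intOn _ F
  suffices htop : 𝔞 = ⊤ by
    have := (h𝔞 1).1 (htop ▸ Submodule.mem_top)
    rwa [map_one, one_smul] at this
  by_contra hne
  obtain ⟨p, hpm, hp⟩ := Ideal.exists_le_maximal 𝔞 hne
  have hpp : p.IsPrime := hpm.isPrime
  rcases finite_or_infinite (D ⧸ p) with hfin | hinf
  · by_cases hpt : IsTLocalizing p
    · have hmax : IsTMaximal p := ⟨⟨hpt.isTIdeal, hpp.ne_top⟩, fun I hI hle =>
        (hpm.eq_of_le hI.2 hle).ge⟩
      have hres : Finite p.ResidueField :=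
        Finite.of_surjective _ (Ideal.bijective_algebraMap_quotient_residueField p).2
      obtain ⟨s, hs, hsM⟩ := exists_smul_mem_span_of_localization hinj _ hφ hL hA
        (H p hpt hmax hres) hf
      exact hs (hp hsM)
    · obtain ⟨s, hs, hF⟩ := exists_C_mul_eq_map_of_not_isTLocalizing hinj hpt
        ((isLocallyTLinked_iff hinj).1 hA p) hf
      exact hs (hp (of_map s hF))
  · obtain ⟨s, hs, hF⟩ := exists_C_mul_eq_map
      ((IsFractionRing.injective A (FractionRing A)).comp hinj) p hf
    exact hs (hp (of_map s hF))

end Main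

theorem theorem3p6 {D : Type*} [CommRing D] [IsDomain D] [Infinite D]
    (hflat : Module.Flat D (IntRing D)) :
    IsPolynomiallyLTRegular D ↔
      IsPolynomiallyLRegular D ∧
        ∀ (p : Ideal D) [p.IsPrime],
          IsTLocalizing p → IsTMaximal p → Finite p.ResidueField →
            IsPolynomiallyLTRegular (Localization.AtPrime p) :=
  ⟨fun h => ⟨h.isPolynomiallyLRegular, fun p _ _ _ _ =>
    h.localization p.primeCompl p.primeCompl_le_nonZeroDivisors⟩,
    fun h => h.1.isPolynomiallyLTRegular h.2⟩
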